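/- Fix $y\in\mathbb R$. Let $p_j=p_j(x,y)$ ($j\ge 0$) be the unique monic polynomials with $\deg p_j=j$ that are orthogonal for $(f,g)_2^y=\int_{-\infty}^y e^{-x^2}f(x)g(x)\,dx$, and let $h_j=(p_j,p_j)_2^y$. For polynomials with coefficients in $\mathbb K\in\{\mathbb R,\mathbb C\}$ define the (bilinear) modified $\beta=4$ skew-inner product $$\langle\!\langle f,g\rangle\!\rangle_4^y=\frac12\int_{-\infty}^y e^{-x^2}\bigl[f(x)g'(x)-g(x)f'(x)\bigr]dx .$$ Monic polynomials $\tilde Q_j$ with $\deg\tilde Q_j=j$ are called skew-orthogonal with normalisations $\tilde q_j$ if, for all $j,k\ge0$, $\langle\!\langle \tilde Q_{2j},\tilde Q_{2k}\rangle\!\rangle_4^y=\langle\!\langle \tilde Q_{2j+1},\tilde Q_{2k+1}\rangle\!\rangle_4^y=0$ and $\langle\!\langle \tilde Q_{2j},\tilde Q_{2k+1}\rangle\!\rangle_4^y=-\langle\!\langle \tilde Q_{2k+1},\tilde Q_{2j}\rangle\!\rangle_4^y=\tilde q_j\,\delta_{j,k}$. Put $\Omega_{j,k}=e^{-y^2}p_j(y,y)p_k(y,y)$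 and let $w_{j,k}=\delta_{j+1,k}h_k+\tfrac12\Omega_{j,k}$ for $j<k$, $w_{j,j}=0$, and $w_{j,k}=-w_{k,j}$ for $j>k$. Let $\mathbf W_m=[w_{a,b}]_{a,b=0,\dots,m}$, let $\mathbf W_m^{(\eta\mapsto\nu)}$ be the matrix obtained from $\mathbf W_m$ by replacing every occurrence of the index $\eta$ by $\nu$ (that is, $[w_{\tau(a),\tau(b)}]_{a,b=0,\dots,m}$ with $\tau(\eta)=\nu$ and $\tau(a)=a$ for $a\ne\eta$), and let $\mathrm{Pf}$ denote the Pfaffian, with the convention $\mathrm{Pf}\,\mathbf W_{-1}=1$. Then $w_{j,k}=\langle\!\langle p_j,p_k\rangle\!\rangle_4^y$ for all $j,k\ge 0$, and $\mathrm{Pf}\,\mathbf W_{2n-1}\neq0$ for all $n\ge0$. Every sequence of monic skew-orthogonal polynomials has the normalisations $$\tilde q_j=\frac{\mathrm{Pf}\,\mathbf W_{2j+1}}{\mathrm{Pf}\,\mathbf W_{2j-1}}\qquad(j\ge0)$$ and can be expanded as $\tilde Q_j=\sum_{k=0}^{j}\tilde\alpha_{j,k}\,p_k$ with coefficients $\tilde\alpha_{j,k}\in\mathbb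 K$, where $\tilde\alpha_{j,j}=1$ for all $j$. Such sequences satisfying in addition $\tilde\alpha_{j,j-1}=0$ for all odd $j$ exist, and for them, for $j\ge2$, $$\tilde\alpha_{j,k}=\begin{cases}-\dfrac{\mathrm{Pf}\,\mathbf W_{j-1}^{(k\mapsto j)}}{\mathrm{Pf}\,\mathbf W_{j-1}}, & j\text{ even},\ 0\le k\le j-1,\\[2ex]-\dfrac{\mathrm{Pf}\,\mathbf W_{j-2}^{(k\mapsto j)}}{\mathrm{Pf}\,\mathbf W_{j-2}}, & j\text{ odd},\ 0\le k\le j-2.\end{cases}$$ -/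

import Mathlib

open Polynomial

/-! ### The truncated Gaussian inner product and its monic orthogonal polynomials -/

/-- The inner product `(f, g)_2^y = ∫_{-∞}^y e^{-x²} f(x) g(x) dx`. -/
noncomputable def ip2 (y : ℝ) (f g : ℝ[X]) : ℝ :=
  ∫ x in Set.Iic y, Real.exp (-x ^ 2) * (f.eval x * g.eval x)

/-- `p` is a sequence of monic polynomials, `p j` of degree `j`, which are pairwise orthogonal
for `(·, ·)_2^y`. -/
structure IsMonicOrthogonal (y : ℝ) (p : ℕ → ℝ[X]) : Prop where
  monic : ∀ j, (p j).Monic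
  natDegree : ∀ j, (p j).natDegree = j
  orthogonal : ∀ j k, j ≠ k → ip2 y (p j) (p k) = 0

theorem integrable_exp_mul_poly (f : ℝ[X]) :
    MeasureTheory.Integrable (fun x : ℝ => Real.exp (-x ^ 2) * f.eval x) := by
  induction f using Polynomial.induction_on' with
  | add p q hp hq =>
    refine (hp.add hq).congr (Filter.Eventually.of_forall fun x => ?_)
    simp only [Pi.add_apply, eval_add, mul_add]
  | monomial n a =>
    have h := integrable_rpow_mul_exp_neg_mul_sq (b := 1) one_pos (s := (n : ℝ))
      (lt_of_lt_of_le (by norm_num) (Nat.cast_nonneg n))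
    refine (h.const_mul a).congr (Filter.Eventually.of_forall fun x => ?_)
    simp only [Real.rpow_natCast, eval_monomial, neg_mul, one_mul]
    ring

theorem integrable_ip2 (f g : ℝ[X]) :
    MeasureTheory.Integrable (fun x : ℝ => Real.exp (-x ^ 2) * (f.eval x * g.eval x)) := by
  simpa using integrable_exp_mul_poly (f * g)

theorem ip2_comm (y : ℝ) (f g : ℝ[X]) : ip2 y f g = ip2 y g f := by
  simp only [ip2, mul_comm (f.eval _)]

theorem ip2_add_left (y : ℝ) (f g k : ℝ[X]) : ip2 y (f + g) k = ip2 y f k + ip2 y g k := by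
  unfold ip2
  rw [← MeasureTheory.integral_add (integrable_ip2 f k).integrableOn
    (integrable_ip2 g k).integrableOn]
  refine MeasureTheory.integral_congr_ae (Filter.Eventually.of_forall fun x => ?_)
  simp only [eval_add]
  ring

theorem ip2_smul_left (y a : ℝ) (f k : ℝ[X]) : ip2 y (a • f) k = a * ip2 y f k := by
  unfold ip2
  rw [← MeasureTheory.integral_const_mul]
  refine MeasureTheory.integral_congr_ae (Filter.Eventually.of_forall fun x => ?_)
  simp only [eval_smul, smul_eq_mul]
  ring

/-- `(·, ·)_2^y` as a bilinear map. -/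
noncomputable def ip2Bilin (y : ℝ) : ℝ[X] →ₗ[ℝ] ℝ[X] →ₗ[ℝ] ℝ :=
  LinearMap.mk₂ ℝ (ip2 y) (ip2_add_left y) (ip2_smul_left y)
    (fun f g k => by rw [ip2_comm, ip2_add_left, ip2_comm y g, ip2_comm y k])
    (fun a f k => by rw [ip2_comm, ip2_smul_left, ip2_comm y k, smul_eq_mul])

theorem ip2_self_eq_zero (y : ℝ) (f : ℝ[X]) (h : ip2 y f f = 0) : f = 0 := by
  unfold ip2 at h
  rw [MeasureTheory.integral_eq_zero_iff_of_nonneg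
    (fun x => mul_nonneg (Real.exp_pos _).le (mul_self_nonneg _))
    (integrable_ip2 f f).integrableOn] at h
  by_contra hf
  have hfin : {x : ℝ | f.eval x = 0}.Finite := by
    have := f.rootSet_finite ℝ
    refine this.subset fun x hx => ?_
    rw [mem_rootSet]
    exact ⟨hf, by simpa using hx⟩
  have hz : (MeasureTheory.volume.restrict (Set.Iic y)) {x : ℝ | f.eval x = 0} = 0 :=
    hfin.measure_zero _
  have hall : (MeasureTheory.volume.restrict (Set.Iic y)) {x : ℝ | ¬ f.eval x = 0} = 0 := by
    refine MeasureTheory.measure_mono_null (fun x hx => ?_) (MeasureTheory.ae_iff.mp h)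
    have hx' : f.eval x ≠ 0 := hx
    simp [hx', (Real.exp_pos _).ne']
  have huniv : (MeasureTheory.volume.restrict (Set.Iic y)) Set.univ = 0 := by
    refine MeasureTheory.measure_mono_null (fun x _ => ?_)
      (MeasureTheory.measure_union_null hz hall)
    exact em (f.eval x = 0)
  simp at huniv

theorem exists_unique_isMonicOrthogonal (y : ℝ) : ∃! p, IsMonicOrthogonal y p := by
  have key : ∀ j : ℕ, ∃ f : ℝ[X], f.Monic ∧ f.natDegree = j ∧
      ∀ g ∈ degreeLT ℝ j, ip2 y f g = 0 := by
    intro j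
    let V := degreeLT ℝ j
    have : FiniteDimensional ℝ V := (degreeLTEquiv ℝ j).symm.finiteDimensional
    let T : V →ₗ[ℝ] Module.Dual ℝ V := (ip2Bilin y).domRestrict₁₂ V V
    have hinj : Function.Injective T := by
      rw [injective_iff_map_eq_zero]
      intro v hv
      have : T v v = 0 := by rw [hv]; rfl
      exact Subtype.ext (ip2_self_eq_zero y v this)
    have hsurj : Function.Surjective T :=
      (LinearMap.injective_iff_surjective_of_finrank_eq_finrank
        (Subspace.dual_finrank_eq).symm).mp hinj
    obtain ⟨r, hr⟩ := hsurj ((ip2Bilin y (X ^ j)).domRestrict V)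
    have hdeg : (r : ℝ[X]).degree < (j : ℕ) := mem_degreeLT.mp r.2
    refine ⟨X ^ j - (r : ℝ[X]), monic_X_pow_sub hdeg, ?_, fun g hg => ?_⟩
    · apply natDegree_eq_of_degree_eq_some
      rw [degree_sub_eq_left_of_degree_lt (by simpa using hdeg)]
      simp
    · have h1 : ip2Bilin y r g = ip2Bilin y (X ^ j) g := LinearMap.congr_fun hr ⟨g, hg⟩
      have h2 : ip2Bilin y (X ^ j - (r : ℝ[X])) g = 0 := by
        rw [LinearMap.map_sub₂, h1, sub_self]
      exact h2
  choose p hm hd ho using key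
  have hlt : ∀ j k, k < j → ip2 y (p j) (p k) = 0 := fun j k hjk =>
    ho j _ (mem_degreeLT.mpr (by
      rw [degree_eq_natDegree (hm k).ne_zero, hd k]; exact_mod_cast hjk))
  refine ⟨p, ⟨hm, hd, fun j k hjk => ?_⟩, fun p' hp' => ?_⟩
  · rcases lt_or_gt_of_ne hjk with h | h
    · rw [ip2_comm]; exact hlt k j h
    · exact hlt j k h
  · funext j
    let S : Polynomial.Sequence ℝ := ⟨p', fun i => by
      rw [degree_eq_natDegree (hp'.monic i).ne_zero, hp'.natDegree i]⟩
    have hspan : degreeLT ℝ j = Submodule.span ℝ (S '' Set.Iio j) := by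
      rw [S.span_degreeLT fun i _ => (show IsUnit (p' i).leadingCoeff by
        rw [hp'.monic i]; exact isUnit_one)]
    have ho' : ∀ g ∈ degreeLT ℝ j, ip2 y (p' j) g = 0 := by
      intro g hg
      have hle : Submodule.span ℝ (S '' Set.Iio j) ≤ LinearMap.ker (ip2Bilin y (p' j)) := by
        rw [Submodule.span_le]
        rintro _ ⟨i, hi, rfl⟩
        exact hp'.orthogonal j i (Nat.ne_of_gt hi)
      rw [hspan] at hg
      exact hle hg
    have hmem : p' j - p j ∈ degreeLT ℝ j := by
      rw [mem_degreeLT]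
      have h1 : (p' j).degree = j := by
        rw [degree_eq_natDegree (hp'.monic j).ne_zero, hp'.natDegree j]
      have h2 : (p j).degree = j := by
        rw [degree_eq_natDegree (hm j).ne_zero, hd j]
      have := degree_sub_lt_left (h1.trans h2.symm) (hp'.monic j).ne_zero
        ((hp'.monic j).leadingCoeff.trans (hm j).leadingCoeff.symm)
      rwa [h1] at this
    have h0 : ip2Bilin y (p' j - p j) (p' j - p j) = 0 := by
      have h1 : ip2Bilin y (p' j) (p' j - p j) = 0 := ho' _ hmem
      have h2 : ip2Bilin y (p j) (p' j - p j) = 0 := ho j _ hmem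
      rw [LinearMap.map_sub₂, h1, h2, sub_zero]
    exact sub_eq_zero.mp (ip2_self_eq_zero y _ h0)

/-- The monic polynomials `p_j(x, y)` orthogonal with respect to `(·, ·)_2^y`. -/
noncomputable def nmPoly (y : ℝ) : ℕ → ℝ[X] :=
  (exists_unique_isMonicOrthogonal y).choose

theorem nmPoly_spec (y : ℝ) : IsMonicOrthogonal y (nmPoly y) :=
  (exists_unique_isMonicOrthogonal y).choose_spec.1

/-- The normalisation `h_j(y) = (p_j, p_j)_2^y`. -/
noncomputable def nmNorm (y : ℝ) (j : ℕ) : ℝ :=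
  ip2 y (nmPoly y j) (nmPoly y j)

/-! ### Pfaffians and the matrices `W` -/

/-- The Pfaffian of an antisymmetric matrix of size `2n`, as a sum over permutations:
`Pf M = 1 / (2^n n!) ∑_σ sgn(σ) ∏_i M_{σ(2i), σ(2i+1)}` (indices starting at `0`).
For `n = 0` it is `1`. -/
noncomputable def pfaffian {n : ℕ} (M : Matrix (Fin (2 * n)) (Fin (2 * n)) ℝ) : ℝ :=
  (1 / (2 ^ n * (n.factorial : ℝ))) *
    ∑ σ : Equiv.Perm (Fin (2 * n)), ((Equiv.Perm.sign σ : ℤ) : ℝ) *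
      ∏ i : Fin n, M (σ ⟨2 * i.1, by omega⟩) (σ ⟨2 * i.1 + 1, by omega⟩)

/-- `Ω_{j,k} = e^{-y²} p_j(y, y) p_k(y, y)`. -/
noncomputable def omegaEntry (y : ℝ) (j k : ℕ) : ℝ :=
  Real.exp (-y ^ 2) * ((nmPoly y j).eval y * (nmPoly y k).eval y)

/-- `w_{j,k}`: for `j < k` it is `δ_{j+1,k} h_k + Ω_{j,k} / 2`, extended antisymmetrically to
all pairs of indices. -/
noncomputable def wEntry (y : ℝ) (j k : ℕ) : ℝ :=
  if j < k then (if j + 1 = k then nmNorm y k else 0) + omegaEntry y j k / 2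
  else if k < j then -((if k + 1 = j then nmNorm y j else 0) + omegaEntry y k j / 2)
  else 0

/-- `matW y n` is the antisymmetric matrix `W_{2n-1} = [w_{a,b}]` with `a, b = 0, …, 2n-1`
(for `n = 0` the empty matrix `W_{-1}`). -/
noncomputable def matW (y : ℝ) (n : ℕ) : Matrix (Fin (2 * n)) (Fin (2 * n)) ℝ :=
  Matrix.of fun a b => wEntry y a b

/-- `matWRepl y n k j` is `W_{2n-1}^{(k ↦ j)}`: the matrix `W_{2n-1}` with all occurrences of
the index `k` replaced by the index `j`. -/
noncomputable def matWRepl (y : ℝ) (n k j : ℕ) : Matrix (Fin (2 * n)) (Fin (2 * n)) ℝ :=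
  Matrix.of fun a b =>
    wEntry y (if a.1 = k then j else a.1) (if b.1 = k then j else b.1)

/-! ### The modified `β = 4` skew-inner product and its skew-orthogonal polynomials -/

/-- The modified skew-inner product
`⟪f, g⟫_4^y = (1/2) ∫_{-∞}^y e^{-x²} (f(x) g'(x) - g(x) f'(x)) dx`
on polynomials with real or complex coefficients (bilinear, no conjugation). -/
noncomputable def skewIP4 {𝕜 : Type*} [RCLike 𝕜] (y : ℝ) (f g : 𝕜[X]) : 𝕜 :=
  (1 / 2) * ∫ x in Set.Iic y, ((Real.exp (-x ^ 2) : ℝ) : 𝕜) *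
    (f.eval (x : 𝕜) * (derivative g).eval (x : 𝕜) -
      g.eval (x : 𝕜) * (derivative f).eval (x : 𝕜))

/-- `p_j(x, y)`, viewed with coefficients in `𝕜`. -/
noncomputable def nmPolyK (𝕜 : Type*) [RCLike 𝕜] (y : ℝ) (j : ℕ) : 𝕜[X] :=
  (nmPoly y j).map (algebraMap ℝ 𝕜)

/-- `Q` is a sequence of monic skew-orthogonal polynomials, `Q j` of degree `j`, for
`⟪·, ·⟫_4^y`, with normalisations `q`. -/
structure IsSkewOrthogonal {𝕜 : Type*} [RCLike 𝕜] (y : ℝ) (Q : ℕ → 𝕜[X]) (q : ℕ → 𝕜) :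
    Prop where
  monic : ∀ j, (Q j).Monic
  natDegree : ∀ j, (Q j).natDegree = j
  even_even : ∀ j k, skewIP4 y (Q (2 * j)) (Q (2 * k)) = 0
  odd_odd : ∀ j k, skewIP4 y (Q (2 * j + 1)) (Q (2 * k + 1)) = 0
  even_odd : ∀ j k, skewIP4 y (Q (2 * j)) (Q (2 * k + 1)) = if j = k then q j else 0
  odd_even : ∀ j k, skewIP4 y (Q (2 * k + 1)) (Q (2 * j)) = -(if j = k then q j else 0)

/-- `Q_j = α_{j,j} p_j + α_{j,j-1} p_{j-1} + ⋯ + α_{j,0} p_0` for every `j`. -/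
def HasCoefficients {𝕜 : Type*} [RCLike 𝕜] (y : ℝ) (Q : ℕ → 𝕜[X]) (α : ℕ → ℕ → 𝕜) : Prop :=
  ∀ j, Q j = ∑ k ∈ Finset.range (j + 1), C (α j k) * nmPolyK 𝕜 y k

/-! Write B for the skew form. Integrating by parts, B(f, g) is half the boundary term e^{-y²} f(y)
g(y) plus (g, X f - f')_2. For monic f of degree j, X f - f' is monic of degree j + 1, so
orthogonality of the p_k yields the entries w_{j,k}. Hence the W are Gram matrices of the p_j for
the alternating form B, and replacing an index amounts to replacing a vector.

Up to the factor 2^n n!, the Pfaffian of a Gram matrix is an alternating multilinear function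
`gramPf` of the 2n vectors, and two facts about it carry the proof. Cramer's rule
(`gramPf_update_of_orthogonal`): if x + ∑ c_k v_k is orthogonal to every v_i, replacing v_t by x
multiplies the Pfaffian by -c_t. Recursion (`gramPf_succ_of_orthogonal`): if a and b agree with the
last two vectors modulo earlier ones, and a is orthogonal to the first 2n, then B(a, b) splits off.

The Pfaffians are nonzero by induction: correct p_{2n} to a monic a orthogonal to the earlier p_i
and take b = X a, so that B(a, X a) = (a, a)_2 / 2 ≠ 0. Solvability then gives existence, the
recursion the normalisations, and Cramer's rule the coefficients. -/

/-! ### Pfaffians of Gram matrices as alternating maps -/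

section Pairing

variable {K V : Type*} [CommRing K] [AddCommGroup V] [Module K V]

/-- The index `2 i`. -/
def pairFst {n : ℕ} (i : Fin n) : Fin (2 * n) := ⟨2 * i.1, by omega⟩

/-- The index `2 i + 1`. -/
def pairSnd {n : ℕ} (i : Fin n) : Fin (2 * n) := ⟨2 * i.1 + 1, by omega⟩

theorem pairFst_injective {n : ℕ} : Function.Injective (pairFst : Fin n → Fin (2 * n)) :=
  fun i j h => by simp only [pairFst, Fin.mk.injEq] at h; exact Fin.ext (by omega)

theorem pairSnd_injective {n : ℕ} : Function.Injective (pairSnd : Fin n → Fin (2 * n)) :=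
  fun i j h => by simp only [pairSnd, Fin.mk.injEq] at h; exact Fin.ext (by omega)

theorem pairFst_ne_pairSnd {n : ℕ} (i j : Fin n) : pairFst i ≠ pairSnd j :=
  fun h => by simp only [pairFst, pairSnd, Fin.mk.injEq] at h; omega

theorem eq_pairFst_or_eq_pairSnd {n : ℕ} (t : Fin (2 * n)) :
    ∃ i : Fin n, t = pairFst i ∨ t = pairSnd i :=
  ⟨⟨t.1 / 2, by omega⟩, by simp only [pairFst, pairSnd, Fin.ext_iff]; omega⟩

/-- Each position occurs in exactly one factor of the product; the other factors are constants. -/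
theorem exists_linearMap_prod_update (B : V →ₗ[K] V →ₗ[K] K) {n : ℕ}
    [DecidableEq (Fin (2 * n))] (v : Fin (2 * n) → V) (t : Fin (2 * n)) :
    ∃ φ : V →ₗ[K] K, ∀ x, ∏ i : Fin n, B (Function.update v t x (pairFst i))
      (Function.update v t x (pairSnd i)) = φ x := by
  obtain ⟨i, rfl | rfl⟩ := eq_pairFst_or_eq_pairSnd t
  · refine ⟨(∏ j ∈ Finset.univ.erase i, B (v (pairFst j)) (v (pairSnd j))) •
      B.flip (v (pairSnd i)), fun x => ?_⟩
    rw [← Finset.prod_erase_mul _ _ (Finset.mem_univ i), Function.update_self,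
      Function.update_of_ne (pairFst_ne_pairSnd i i).symm]
    simp only [LinearMap.smul_apply, LinearMap.flip_apply, smul_eq_mul]
    congr 1
    refine Finset.prod_congr rfl fun j hj => ?_
    rw [Function.update_of_ne (pairFst_injective.ne (Finset.ne_of_mem_erase hj)),
      Function.update_of_ne (pairFst_ne_pairSnd i j).symm]
  · refine ⟨(∏ j ∈ Finset.univ.erase i, B (v (pairFst j)) (v (pairSnd j))) •
      B (v (pairFst i)), fun x => ?_⟩
    rw [← Finset.prod_erase_mul _ _ (Finset.mem_univ i), Function.update_self,
      Function.update_of_ne (pairFst_ne_pairSnd i i)]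
    simp only [LinearMap.smul_apply, smul_eq_mul]
    congr 1
    refine Finset.prod_congr rfl fun j hj => ?_
    rw [Function.update_of_ne (pairSnd_injective.ne (Finset.ne_of_mem_erase hj)),
      Function.update_of_ne (pairFst_ne_pairSnd j i)]

/-- The multilinear map `v ↦ ∏ i, B (v (2 i)) (v (2 i + 1))`. -/
def pairProd (B : V →ₗ[K] V →ₗ[K] K) (n : ℕ) :
    MultilinearMap K (fun _ : Fin (2 * n) => V) K where
  toFun v := ∏ i : Fin n, B (v (pairFst i)) (v (pairSnd i))
  map_update_add' v t x y := by
    obtain ⟨φ, hφ⟩ := exists_linearMap_prod_update B v t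
    simp only [hφ, map_add]
  map_update_smul' v t c x := by
    obtain ⟨φ, hφ⟩ := exists_linearMap_prod_update B v t
    simp only [hφ, map_smul]

theorem pairProd_apply (B : V →ₗ[K] V →ₗ[K] K) (n : ℕ) (v : Fin (2 * n) → V) :
    pairProd B n v = ∏ i : Fin n, B (v (pairFst i)) (v (pairSnd i)) :=
  rfl

/-- The unnormalised Pfaffian of the Gram matrix `B (v i) (v j)`, as an alternating map of `v`. -/
noncomputable def gramPf (B : V →ₗ[K] V →ₗ[K] K) (n : ℕ) : V [⋀^Fin (2 * n)]→ₗ[K] K :=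
  MultilinearMap.alternatization (pairProd B n)

theorem gramPf_apply (B : V →ₗ[K] V →ₗ[K] K) (n : ℕ) (v : Fin (2 * n) → V) :
    gramPf B n v = ∑ σ : Equiv.Perm (Fin (2 * n)),
      Equiv.Perm.sign σ • pairProd B n (fun i => v (σ i)) := by
  rw [gramPf, MultilinearMap.alternatization_apply]
  rfl

theorem gramPf_zero (B : V →ₗ[K] V →ₗ[K] K) (v : Fin (2 * 0) → V) : gramPf B 0 v = 1 := by
  have : IsEmpty (Fin (2 * 0)) := Fin.isEmpty
  rw [gramPf_apply, Fintype.sum_subsingleton _ 1, pairProd_apply, Fin.prod_univ_zero,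
    Equiv.Perm.sign_one, one_smul]

/-- The permutation of positions that exchanges the `i`-th and the `j`-th pair. -/
def swapPairs {n : ℕ} (i j : Fin n) : Equiv.Perm (Fin (2 * n)) :=
  Equiv.swap (pairFst i) (pairFst j) * Equiv.swap (pairSnd i) (pairSnd j)

theorem swapPairs_pairFst {n : ℕ} (i j k : Fin n) :
    swapPairs i j (pairFst k) = pairFst (Equiv.swap i j k) := by
  rw [swapPairs, Equiv.Perm.mul_apply, Equiv.swap_apply_of_ne_of_ne
    (pairFst_ne_pairSnd _ _) (pairFst_ne_pairSnd _ _), pairFst_injective.swap_apply]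

theorem swapPairs_pairSnd {n : ℕ} (i j k : Fin n) :
    swapPairs i j (pairSnd k) = pairSnd (Equiv.swap i j k) := by
  rw [swapPairs, Equiv.Perm.mul_apply, pairSnd_injective.swap_apply, Equiv.swap_apply_of_ne_of_ne
    (pairFst_ne_pairSnd _ _).symm (pairFst_ne_pairSnd _ _).symm]

theorem sign_swapPairs {n : ℕ} (i j : Fin n) : Equiv.Perm.sign (swapPairs i j) = 1 := by
  rw [swapPairs, Equiv.Perm.sign_mul, Equiv.Perm.sign_swap', Equiv.Perm.sign_swap']
  by_cases h : i = j
  · simp [h]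
  · simp [pairFst_injective.ne h, pairSnd_injective.ne h]

theorem pairProd_swapPairs (B : V →ₗ[K] V →ₗ[K] K) {n : ℕ} (i j : Fin n)
    (v : Fin (2 * n) → V) :
    pairProd B n (fun t => v (swapPairs i j t)) = pairProd B n v := by
  rw [pairProd_apply, pairProd_apply, ← Equiv.prod_comp (Equiv.swap i j)
    (fun k => B (v (pairFst k)) (v (pairSnd k)))]
  simp only [swapPairs_pairFst, swapPairs_pairSnd]

theorem pairProd_swap (B : V →ₗ[K] V →ₗ[K] K) (hB : B.IsAlt) {n : ℕ} (i : Fin n)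
    (v : Fin (2 * n) → V) :
    pairProd B n (fun t => v (Equiv.swap (pairFst i) (pairSnd i) t)) = -pairProd B n v := by
  rw [pairProd_apply, pairProd_apply, ← Finset.prod_erase_mul _ _ (Finset.mem_univ i),
    ← Finset.prod_erase_mul _ _ (Finset.mem_univ i), Equiv.swap_apply_left,
    Equiv.swap_apply_right, ← mul_neg, hB.neg]
  congr 1
  refine Finset.prod_congr rfl fun j hj => ?_
  have hji := Finset.ne_of_mem_erase hj
  rw [Equiv.swap_apply_of_ne_of_ne (pairFst_injective.ne hji) (pairFst_ne_pairSnd j i),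
    Equiv.swap_apply_of_ne_of_ne (pairFst_ne_pairSnd i j).symm (pairSnd_injective.ne hji)]

/-- The symmetries of the pairing product act transitively on positions. -/
theorem exists_perm_pairProd (B : V →ₗ[K] V →ₗ[K] K) (hB : B.IsAlt) {n : ℕ} (l : Fin n)
    (t : Fin (2 * n)) : ∃ ρ : Equiv.Perm (Fin (2 * n)),
      ρ (pairFst l) = t ∧ ∀ v : Fin (2 * n) → V,
        Equiv.Perm.sign ρ • pairProd B n (fun i => v (ρ i)) = pairProd B n v := by
  obtain ⟨i, rfl | rfl⟩ := eq_pairFst_or_eq_pairSnd t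
  · refine ⟨swapPairs i l, by rw [swapPairs_pairFst, Equiv.swap_apply_right], fun v => ?_⟩
    rw [sign_swapPairs, pairProd_swapPairs, one_smul]
  · refine ⟨swapPairs i l * Equiv.swap (pairFst l) (pairSnd l), ?_, fun v => ?_⟩
    · rw [Equiv.Perm.mul_apply, Equiv.swap_apply_left, swapPairs_pairSnd, Equiv.swap_apply_right]
    · have h := pairProd_swap B hB l (fun k => v (swapPairs i l k))
      rw [pairProd_swapPairs] at h
      rw [Equiv.Perm.sign_mul, sign_swapPairs, one_mul,
        Equiv.Perm.sign_swap (pairFst_ne_pairSnd l l)]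
      simp only [Equiv.Perm.mul_apply]
      rw [h]
      simp

/-- Sort the permutations by the position sent to `pairFst l`. The symmetries of the pairing make
the 2n classes contribute equally, so one class suffices. -/
theorem gramPf_eq_sum_fixing (B : V →ₗ[K] V →ₗ[K] K) (hB : B.IsAlt) {n : ℕ} (l : Fin n)
    (v : Fin (2 * n) → V) :
    gramPf B n v = (2 * n : K) * ∑ σ : Equiv.Perm (Fin (2 * n)),
      if σ (pairFst l) = pairFst l then
        Equiv.Perm.sign σ • pairProd B n (fun i => v (σ i)) else 0 := by
  have h1 : ∀ σ : Equiv.Perm (Fin (2 * n)),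
      Equiv.Perm.sign σ • pairProd B n (fun i => v (σ i)) =
      ∑ t, if σ t = pairFst l then
        Equiv.Perm.sign σ • pairProd B n (fun i => v (σ i)) else 0 := by
    intro σ
    have h : ∀ t, (σ t = pairFst l ↔ t = σ.symm (pairFst l)) := fun t => by
      rw [Equiv.eq_symm_apply]
    simp only [h, Finset.sum_ite_eq', Finset.mem_univ, if_true]
  have h2 : ∀ t : Fin (2 * n), (∑ σ : Equiv.Perm (Fin (2 * n)),
      if σ t = pairFst l then
        Equiv.Perm.sign σ • pairProd B n (fun i => v (σ i)) else 0) =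
      ∑ σ : Equiv.Perm (Fin (2 * n)),
      if σ (pairFst l) = pairFst l then
        Equiv.Perm.sign σ • pairProd B n (fun i => v (σ i)) else 0 := by
    intro t
    obtain ⟨ρ, hρt, hρ⟩ := exists_perm_pairProd B hB l t
    rw [← Equiv.sum_comp (Equiv.mulRight ρ) (fun σ : Equiv.Perm (Fin (2 * n)) =>
      if σ (pairFst l) = pairFst l then
        Equiv.Perm.sign σ • pairProd B n (fun i => v (σ i)) else 0)]
    refine Finset.sum_congr rfl fun σ _ => ?_
    simp only [Equiv.coe_mulRight, Equiv.Perm.mul_apply, hρt, Equiv.Perm.sign_mul, mul_smul,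
      hρ (fun i => v (σ i))]
  rw [gramPf_apply, Finset.sum_congr rfl fun σ _ => h1 σ, Finset.sum_comm,
    Finset.sum_congr rfl fun t _ => h2 t]
  simp

/-- Expansion of the Pfaffian along a vector that is orthogonal to all but the last one. -/
theorem gramPf_succ (B : V →ₗ[K] V →ₗ[K] K) (hB : B.IsAlt) (n : ℕ)
    (v : Fin (2 * (n + 1)) → V)
    (h : ∀ i : Fin (2 * n), B (v (pairFst (Fin.last n))) (v ⟨i.1, by omega⟩) = 0) :
    gramPf B (n + 1) v = (2 * (n + 1) : K) *
      (B (v (pairFst (Fin.last n))) (v (pairSnd (Fin.last n))) *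
        gramPf B n fun i => v ⟨i.1, by omega⟩) := by
  rw [gramPf_eq_sum_fixing B hB (Fin.last n)]
  push_cast
  congr 1
  let f : Fin (2 * n) ≃ {i : Fin (2 * (n + 1)) // i.1 < 2 * n} :=
    { toFun := fun i => ⟨⟨i.1, by omega⟩, i.2⟩
      invFun := fun i => ⟨i.1.1, i.2⟩
      left_inv := fun _ => rfl
      right_inv := fun _ => rfl }
  have hfst : ∀ τ : Equiv.Perm (Fin (2 * n)),
      τ.extendDomain f (pairFst (Fin.last n)) = pairFst (Fin.last n) := fun τ =>
    Equiv.Perm.extendDomain_apply_not_subtype _ _ (by simp [pairFst])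
  have hsnd : ∀ τ : Equiv.Perm (Fin (2 * n)),
      τ.extendDomain f (pairSnd (Fin.last n)) = pairSnd (Fin.last n) := fun τ =>
    Equiv.Perm.extendDomain_apply_not_subtype _ _ (by simp [pairSnd])
  have hlt : ∀ (τ : Equiv.Perm (Fin (2 * n))) (i : Fin (2 * n)),
      τ.extendDomain f ⟨i.1, by omega⟩ = ⟨(τ i).1, by omega⟩ := fun τ i =>
    Equiv.Perm.extendDomain_apply_image τ f i
  rw [gramPf_apply, Finset.mul_sum]
  symm
  -- The surviving permutations are those of the first 2n positions, extended by the identity on the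
  -- last pair.
  refine Finset.sum_of_injOn (fun τ => τ.extendDomain f)
    (Equiv.Perm.extendDomainHom_injective f).injOn
    (fun _ _ => Finset.mem_coe.2 (Finset.mem_univ _)) ?_ ?_
  · intro σ _ hσ
    split_ifs with hσl
    swap
    · rfl
    rw [pairProd_apply, Fin.prod_univ_castSucc, hσl]
    suffices hz : B (v (pairFst (Fin.last n))) (v (σ (pairSnd (Fin.last n)))) = 0 by
      rw [hz, mul_zero, smul_zero]
    by_cases hlt' : (σ (pairSnd (Fin.last n))).1 < 2 * n
    · exact h ⟨_, hlt'⟩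
    -- Otherwise σ fixes both last positions, so it restricts to the first 2n and lies in the image
    -- of `extendDomain`, contrary to `hσ`.
    exfalso
    have hσs : σ (pairSnd (Fin.last n)) = pairSnd (Fin.last n) := by
      have h1 : σ (pairSnd (Fin.last n)) ≠ pairFst (Fin.last n) := fun h' =>
        pairFst_ne_pairSnd (Fin.last n) (Fin.last n) (σ.injective (hσl.trans h'.symm))
      refine Fin.ext ?_
      simp only [pairFst, pairSnd, Fin.val_last, ne_eq, Fin.ext_iff] at h1 ⊢
      have := (σ (pairSnd (Fin.last n))).2
      simp only [pairSnd, Fin.val_last] at this hlt'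
      omega
    have hcases : ∀ i : Fin (2 * (n + 1)), ¬ i.1 < 2 * n →
        i = pairFst (Fin.last n) ∨ i = pairSnd (Fin.last n) := by
      intro i hi
      simp only [pairFst, pairSnd, Fin.ext_iff, Fin.val_last]
      omega
    have hfix : ∀ i : Fin (2 * (n + 1)), ¬ i.1 < 2 * n → σ i = i := by
      intro i hi
      rcases hcases i hi with rfl | rfl
      · exact hσl
      · exact hσs
    have hinv : ∀ i : Fin (2 * (n + 1)), (σ i).1 < 2 * n ↔ i.1 < 2 * n := by
      intro i
      refine ⟨fun hi => ?_, fun hi => ?_⟩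
      · by_contra hi'
        rw [hfix i hi'] at hi
        exact hi' hi
      · by_contra hi'
        have := σ.injective (hfix _ hi')
        rw [this] at hi'
        exact hi' hi
    refine hσ ⟨f.symm.permCongr (σ.subtypePerm hinv), by simp, ?_⟩
    refine Equiv.ext fun i => ?_
    by_cases hi : i.1 < 2 * n
    · refine (Equiv.Perm.extendDomain_apply_subtype _ f hi).trans ?_
      simp [Equiv.permCongr_apply]
    · exact (Equiv.Perm.extendDomain_apply_not_subtype _ f hi).trans (hfix i hi).symm
  · intro τ _
    rw [if_pos (hfst τ), Equiv.Perm.sign_extendDomain, pairProd_apply, pairProd_apply,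
      Fin.prod_univ_castSucc, hfst, hsnd, mul_comm, smul_mul_assoc]
    congr 2
    refine Finset.prod_congr rfl fun i _ => ?_
    have e1 := hlt τ (pairFst i)
    have e2 := hlt τ (pairSnd i)
    exact congrArg₂ (fun a b => B (v a) (v b)) e1.symm e2.symm

theorem pairProd_eq_zero (B : V →ₗ[K] V →ₗ[K] K) (hB : B.IsAlt) {n : ℕ} (v : Fin (2 * n) → V)
    (t : Fin (2 * n)) (h : ∀ i, i ≠ t → B (v t) (v i) = 0) : pairProd B n v = 0 := by
  rw [pairProd_apply]
  obtain ⟨i, rfl | rfl⟩ := eq_pairFst_or_eq_pairSnd t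
  · exact Finset.prod_eq_zero (Finset.mem_univ i) (h _ (pairFst_ne_pairSnd i i).symm)
  · refine Finset.prod_eq_zero (Finset.mem_univ i) ?_
    rw [← hB.neg, h _ (pairFst_ne_pairSnd i i), neg_zero]

theorem gramPf_eq_zero (B : V →ₗ[K] V →ₗ[K] K) (hB : B.IsAlt) {n : ℕ} (v : Fin (2 * n) → V)
    (t : Fin (2 * n)) (h : ∀ i, i ≠ t → B (v t) (v i) = 0) : gramPf B n v = 0 := by
  rw [gramPf_apply]
  refine Finset.sum_eq_zero fun σ _ => ?_
  rw [pairProd_eq_zero B hB _ (σ.symm t) fun i hi => ?_, smul_zero]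
  rw [Equiv.apply_symm_apply]
  exact h _ fun h' => hi (by rw [← h', Equiv.symm_apply_apply])

theorem gramPf_update_eq_zero (B : V →ₗ[K] V →ₗ[K] K) (hB : B.IsAlt) {n : ℕ}
    (v : Fin (2 * n) → V) (t : Fin (2 * n)) (x : V) (h : ∀ i, i ≠ t → B x (v i) = 0) :
    gramPf B n (Function.update v t x) = 0 :=
  gramPf_eq_zero B hB _ t fun i hi => by
    rw [Function.update_self, Function.update_of_ne hi]; exact h i hi

/-- A column operation: the change in entry t is a combination of the other entries, each of which
contributes a repeated argument. -/
theorem AlternatingMap.map_update_of_sub_mem_span {ι : Type*} [DecidableEq ι] {N : Type*}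
    [AddCommGroup N] [Module K N] (f : V [⋀^ι]→ₗ[K] N) (v : ι → V) (t : ι) (x : V)
    (hx : x - v t ∈ Submodule.span K (v '' {t}ᶜ)) : f (Function.update v t x) = f v := by
  have hle : Submodule.span K (v '' {t}ᶜ) ≤
      LinearMap.ker (f.toMultilinearMap.toLinearMap v t) := by
    rw [Submodule.span_le]
    rintro _ ⟨i, hi, rfl⟩
    exact f.map_update_self v (Ne.symm hi)
  have h := LinearMap.mem_ker.1 (hle hx)
  rw [map_sub, sub_eq_zero] at h
  simpa using h

/-- Cramer's rule for Pfaffians. -/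
theorem gramPf_update_of_orthogonal (B : V →ₗ[K] V →ₗ[K] K) (hB : B.IsAlt) {n : ℕ}
    (v : Fin (2 * n) → V) (x : V) (c : Fin (2 * n) → K)
    (h : ∀ i, B (x + ∑ k, c k • v k) (v i) = 0) (t : Fin (2 * n)) :
    gramPf B n (Function.update v t x) = -(c t * gramPf B n v) := by
  have h1 := gramPf_update_eq_zero B hB v t _ fun i _ => h i
  -- For k ≠ t the vector v_k would appear twice, so only the term c_t v_t survives.
  have h2 : gramPf B n (Function.update v t (∑ k, c k • v k)) = c t * gramPf B n v := by
    rw [AlternatingMap.map_update_sum, Finset.sum_eq_single t]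
    · rw [AlternatingMap.map_update_smul, Function.update_eq_self, smul_eq_mul]
    · intro k _ hk
      rw [AlternatingMap.map_update_smul, AlternatingMap.map_update_self _ _ hk.symm, smul_zero]
    · simp
  rw [AlternatingMap.map_update_add, h2] at h1
  exact eq_neg_of_add_eq_zero_left h1

end Pairing

/-! ### Orthogonal corrections and the Pfaffian recursion -/

section Sequences

variable {K V : Type*} [Field K] [AddCommGroup V] [Module K V]

/-- A square linear system in c. Cramer's rule with x = 0 forces solutions of the homogeneous system
to vanish, so the system is solvable. -/
theorem exists_orthogonal_correction (B : V →ₗ[K] V →ₗ[K] K) (hB : B.IsAlt) {n : ℕ}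
    (v : Fin (2 * n) → V) (hv : gramPf B n v ≠ 0) (x : V) :
    ∃ c : Fin (2 * n) → K, ∀ i, B (x + ∑ k, c k • v k) (v i) = 0 := by
  let T : (Fin (2 * n) → K) →ₗ[K] (Fin (2 * n) → K) :=
    LinearMap.pi fun i => (B.flip (v i)) ∘ₗ Fintype.linearCombination K v
  have hT : ∀ c i, T c i = B (∑ k, c k • v k) (v i) := fun c i => by
    simp [T, Fintype.linearCombination_apply]
  have hinj : Function.Injective T := by
    rw [injective_iff_map_eq_zero]
    intro c hc
    funext t
    have h := gramPf_update_of_orthogonal B hB v 0 c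
      (fun i => by rw [zero_add, ← hT, hc, Pi.zero_apply]) t
    rw [AlternatingMap.map_update_zero, zero_eq_neg] at h
    exact (mul_eq_zero.1 h).resolve_right hv
  obtain ⟨c, hc⟩ := LinearMap.injective_iff_surjective.1 hinj fun i => -B x (v i)
  refine ⟨c, fun i => ?_⟩
  rw [map_add, LinearMap.add_apply, ← hT, hc]
  exact add_neg_cancel _

theorem gramPf_succ_of_orthogonal (B : V →ₗ[K] V →ₗ[K] K) (hB : B.IsAlt) (p : ℕ → V) (n : ℕ)
    (a b : V) (ha : a - p (2 * n) ∈ Submodule.span K (p '' Set.Iio (2 * n)))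
    (hab : ∀ i < 2 * n, B a (p i) = 0)
    (hb : b - p (2 * n + 1) ∈ Submodule.span K (p '' Set.Iio (2 * n + 1))) :
    gramPf B (n + 1) (fun i => p i) =
      (2 * (n + 1) : K) * (B a b * gramPf B n fun i => p i) := by
  set P : Fin (2 * (n + 1)) → V := fun i => p i with hP
  set s : Fin (2 * (n + 1)) := pairFst (Fin.last n) with hs
  set t : Fin (2 * (n + 1)) := pairSnd (Fin.last n) with ht
  have hst : s ≠ t := pairFst_ne_pairSnd _ _
  have hsv : s.1 = 2 * n := by simp [hs, pairFst]
  have htv : t.1 = 2 * n + 1 := by simp [ht, pairSnd]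
  -- b goes in before a: b - p (2n+1) may involve p (2n), which must still be an entry.
  have h1 : gramPf B (n + 1) (Function.update P t b) = gramPf B (n + 1) P := by
    refine AlternatingMap.map_update_of_sub_mem_span _ _ _ _ ?_
    rw [hP]
    simp only [htv]
    refine Submodule.span_mono ?_ hb
    rintro _ ⟨i, hi, rfl⟩
    have hi' : i < 2 * n + 1 := hi
    refine ⟨⟨i, by omega⟩, ?_, rfl⟩
    simp only [Set.mem_compl_iff, Set.mem_singleton_iff, Fin.ext_iff, htv]; omega
  have h2 : gramPf B (n + 1) (Function.update (Function.update P t b) s a) =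
      gramPf B (n + 1) (Function.update P t b) := by
    refine AlternatingMap.map_update_of_sub_mem_span _ _ _ _ ?_
    rw [Function.update_of_ne hst, hP]
    simp only [hsv]
    refine Submodule.span_mono ?_ ha
    rintro _ ⟨i, hi, rfl⟩
    have hi' : i < 2 * n := hi
    refine ⟨⟨i, by omega⟩, ?_, ?_⟩
    · simp only [Set.mem_compl_iff, Set.mem_singleton_iff, Fin.ext_iff, hsv]; omega
    · rw [Function.update_of_ne (by simp only [ne_eq, Fin.ext_iff, htv]; omega)]
  have h3 : ∀ i : Fin (2 * n),
      Function.update (Function.update P t b) s a ⟨i.1, by omega⟩ = p i := by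
    intro i
    rw [Function.update_of_ne (by simp only [ne_eq, Fin.ext_iff, hsv]; omega),
      Function.update_of_ne (by simp only [ne_eq, Fin.ext_iff, htv]; omega)]
  rw [← h1, ← h2, gramPf_succ B hB]
  · simp only [h3]
    rw [← hs, ← ht, Function.update_self, Function.update_of_ne hst.symm, Function.update_self]
  · intro i
    rw [h3, ← hs, Function.update_self]
    exact hab i i.2

end Sequences

/-! ### The skew form and integration by parts -/

section Form

variable {𝕜 : Type*} [RCLike 𝕜]

theorem integrable_exp_mul_eval (f : 𝕜[X]) :
    MeasureTheory.Integrable (fun x : ℝ => ((Real.exp (-x ^ 2) : ℝ) : 𝕜) * f.eval (x : 𝕜)) := by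
  induction f using Polynomial.induction_on' with
  | add p q hp hq =>
    refine (hp.add hq).congr (Filter.Eventually.of_forall fun x => ?_)
    simp only [Pi.add_apply, eval_add, mul_add]
  | monomial n a =>
    have h := (integrable_exp_mul_poly (X ^ n)).ofReal (𝕜 := 𝕜)
    refine (h.const_mul a).congr (Filter.Eventually.of_forall fun x => ?_)
    simp only [eval_monomial, eval_pow, eval_X]
    push_cast
    ring

/-- `f ↦ ∫_{-∞}^y e^{-x²} f(x) dx` as a linear map on polynomials. -/
noncomputable def truncGauss (𝕜 : Type*) [RCLike 𝕜] (y : ℝ) : 𝕜[X] →ₗ[𝕜] 𝕜 where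
  toFun f := ∫ x in Set.Iic y, ((Real.exp (-x ^ 2) : ℝ) : 𝕜) * f.eval (x : 𝕜)
  map_add' f g := by
    rw [← MeasureTheory.integral_add (integrable_exp_mul_eval f).integrableOn
      (integrable_exp_mul_eval g).integrableOn]
    simp only [eval_add, mul_add]
  map_smul' c f := by
    rw [RingHom.id_apply, smul_eq_mul, ← MeasureTheory.integral_const_mul]
    simp only [eval_smul, smul_eq_mul]
    congr 1
    funext x
    ring

/-- `⟪·, ·⟫_4^y` as a bilinear map. -/
noncomputable def skewForm (𝕜 : Type*) [RCLike 𝕜] (y : ℝ) : 𝕜[X] →ₗ[𝕜] 𝕜[X] →ₗ[𝕜] 𝕜 :=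
  LinearMap.mk₂ 𝕜 (fun f g => (1 / 2) * truncGauss 𝕜 y (f * derivative g - g * derivative f))
    (fun f f' g => by
      rw [← mul_add, ← map_add]; congr 2; rw [derivative_add]; ring)
    (fun c f g => by
      rw [smul_eq_mul, mul_left_comm, ← smul_eq_mul (a := c), ← map_smul]
      congr 2; rw [derivative_smul, smul_sub, smul_mul_assoc, mul_smul_comm])
    (fun f g g' => by
      rw [← mul_add, ← map_add]; congr 2; rw [derivative_add]; ring)
    (fun c f g => by
      rw [smul_eq_mul, mul_left_comm, ← smul_eq_mul (a := c), ← map_smul]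
      congr 2; rw [derivative_smul, smul_sub, smul_mul_assoc, mul_smul_comm])

theorem skewForm_eq (y : ℝ) (f g : 𝕜[X]) : skewForm 𝕜 y f g =
    (1 / 2) * truncGauss 𝕜 y (f * derivative g - g * derivative f) := rfl

theorem skewForm_apply (y : ℝ) (f g : 𝕜[X]) : skewForm 𝕜 y f g = skewIP4 y f g := by
  simp only [skewForm_eq, truncGauss, skewIP4, LinearMap.coe_mk, AddHom.coe_mk, eval_sub,
    eval_mul]

theorem skewForm_isAlt (y : ℝ) : (skewForm 𝕜 y).IsAlt := fun f => by
  rw [skewForm_eq, sub_self, map_zero, mul_zero]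

theorem truncGauss_mul (y : ℝ) (f g : ℝ[X]) : truncGauss ℝ y (f * g) = ip2 y f g := by
  simp [truncGauss, ip2]

theorem truncGauss_map (y : ℝ) (f : ℝ[X]) :
    truncGauss 𝕜 y (f.map (algebraMap ℝ 𝕜)) = ((truncGauss ℝ y f : ℝ) : 𝕜) := by
  simp only [truncGauss, LinearMap.coe_mk, AddHom.coe_mk]
  rw [← integral_ofReal]
  congr 1
  funext x
  have : (f.map (algebraMap ℝ 𝕜)).eval (x : 𝕜) = ((f.eval x : ℝ) : 𝕜) := by
    rw [← RCLike.algebraMap_eq_ofReal, eval_map_apply]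
  rw [this]
  simp

theorem skewForm_map (y : ℝ) (f g : ℝ[X]) :
    skewForm 𝕜 y (f.map (algebraMap ℝ 𝕜)) (g.map (algebraMap ℝ 𝕜)) =
      ((skewForm ℝ y f g : ℝ) : 𝕜) := by
  rw [skewForm_eq, skewForm_eq, derivative_map, derivative_map, ← Polynomial.map_mul,
    ← Polynomial.map_mul, ← Polynomial.map_sub, truncGauss_map]
  push_cast
  rfl

/-- Integration by parts. -/
theorem truncGauss_derivative (y : ℝ) (f : ℝ[X]) :
    truncGauss ℝ y (derivative f) =
      Real.exp (-y ^ 2) * f.eval y + 2 * truncGauss ℝ y (X * f) := by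
  have hderiv : ∀ x : ℝ, HasDerivAt (fun x : ℝ => Real.exp (-x ^ 2) * f.eval x)
      (Real.exp (-x ^ 2) * (derivative f - C 2 * (X * f)).eval x) x := by
    intro x
    have h1 : HasDerivAt (fun x : ℝ => Real.exp (-x ^ 2)) (Real.exp (-x ^ 2) * -(2 * x)) x := by
      simpa using ((hasDerivAt_pow 2 x).neg).exp
    refine (h1.mul (f.hasDerivAt x)).congr_deriv ?_
    simp only [eval_sub, eval_mul, eval_C, eval_X]
    ring
  have hint := (integrable_exp_mul_poly (derivative f - C 2 * (X * f))).integrableOn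
    (s := Set.Iic y)
  -- The boundary term at -∞ vanishes because the function and its derivative are both integrable.
  have hlim := MeasureTheory.tendsto_zero_of_hasDerivAt_of_integrableOn_Iic
    (fun x _ => hderiv x) hint (integrable_exp_mul_poly f).integrableOn
  have h := MeasureTheory.integral_Iic_of_hasDerivAt_of_tendsto' (fun x _ => hderiv x) hint hlim
  have h2 : truncGauss ℝ y (derivative f - C 2 * (X * f)) = Real.exp (-y ^ 2) * f.eval y := by
    rw [sub_zero] at h
    exact h
  rw [← h2, map_sub, ← smul_eq_C_mul, map_smul, smul_eq_mul]
  ring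

/-- From f g' - g f' = (f g)' - 2 g f', with the total derivative integrated by parts. This brings
in orthogonality for `ip2`. -/
theorem skewForm_eq_add (y : ℝ) (f g : ℝ[X]) :
    skewForm ℝ y f g = Real.exp (-y ^ 2) * (f.eval y * g.eval y) / 2 +
      ip2 y g (X * f - derivative f) := by
  have h := truncGauss_derivative y (f * g)
  rw [← truncGauss_mul, skewForm_eq]
  have h1 : f * derivative g - g * derivative f =
      derivative (f * g) - (2 : ℝ) • (g * derivative f) := by
    rw [derivative_mul, smul_eq_C_mul, C_ofNat]; ring
  have h2 : g * (X * f - derivative f) = X * (f * g) - g * derivative f := by ring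
  rw [h1, h2, map_sub, map_sub, h, map_smul, eval_mul, smul_eq_mul]
  ring

/-- Since f (X f)' - X f f' = f², definiteness of `ip2` becomes available for the skew form; this
drives the nonvanishing of the Pfaffians. -/
theorem skewForm_X_mul (y : ℝ) (f : ℝ[X]) : skewForm ℝ y f (X * f) = ip2 y f f / 2 := by
  rw [skewForm_eq, ← truncGauss_mul]
  have : f * derivative (X * f) - X * f * derivative f = f * f := by
    rw [derivative_mul, derivative_X]; ring
  rw [this]
  ring

end Form

/-! ### Monic sequences and the degree filtration -/

section MonicSequences

variable {K : Type*} [Field K]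

theorem degreeLT_eq_span_of_monic {P : ℕ → K[X]} (hm : ∀ j, (P j).Monic)
    (hd : ∀ j, (P j).natDegree = j) (n : ℕ) :
    degreeLT K n = Submodule.span K (P '' Set.Iio n) := by
  let S : Polynomial.Sequence K := ⟨P, fun i => by
    rw [degree_eq_natDegree (hm i).ne_zero, hd i]⟩
  exact (S.span_degreeLT fun i _ => (show IsUnit (P i).leadingCoeff by
    rw [hm i]; exact isUnit_one)).symm

theorem sub_mem_degreeLT_of_monic {f g : K[X]} {n : ℕ} (hf : f.Monic) (hfd : f.natDegree = n)
    (hg : g.Monic) (hgd : g.natDegree = n) : f - g ∈ degreeLT K n := by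
  rw [mem_degreeLT]
  have h1 : f.degree = n := by rw [degree_eq_natDegree hf.ne_zero, hfd]
  have h2 : g.degree = n := by rw [degree_eq_natDegree hg.ne_zero, hgd]
  have := degree_sub_lt_left (h1.trans h2.symm) hf.ne_zero
    (hf.leadingCoeff.trans hg.leadingCoeff.symm)
  rwa [h1] at this

theorem mem_degreeLT_of_natDegree_lt {f : K[X]} {n : ℕ} (h : f.natDegree < n) :
    f ∈ degreeLT K n :=
  mem_degreeLT.2 (degree_le_natDegree.trans_lt (by exact_mod_cast h))

theorem apply_eq_zero_of_mem_degreeLT {P : ℕ → K[X]} (hm : ∀ j, (P j).Monic)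
    (hd : ∀ j, (P j).natDegree = j) {n : ℕ} (φ : K[X] →ₗ[K] K) (h : ∀ i < n, φ (P i) = 0)
    {g : K[X]} (hg : g ∈ degreeLT K n) : φ g = 0 := by
  have hle : degreeLT K n ≤ LinearMap.ker φ := by
    rw [degreeLT_eq_span_of_monic hm hd, Submodule.span_le]
    rintro _ ⟨i, hi, rfl⟩
    exact h i hi
  exact hle hg

end MonicSequences

/-! ### The matrices W as Gram matrices; nonvanishing Pfaffians -/

section Gram

theorem ip2_nmPoly_of_mem_degreeLT (y : ℝ) (k : ℕ) {g : ℝ[X]} (hg : g ∈ degreeLT ℝ k) :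
    ip2 y (nmPoly y k) g = 0 :=
  apply_eq_zero_of_mem_degreeLT (nmPoly_spec y).monic (nmPoly_spec y).natDegree
    (ip2Bilin y (nmPoly y k)) (fun i hi => (nmPoly_spec y).orthogonal k i hi.ne') hg

theorem ip2_nmPoly_of_monic (y : ℝ) (k : ℕ) {g : ℝ[X]} (hg : g.Monic) (hd : g.natDegree = k) :
    ip2 y (nmPoly y k) g = nmNorm y k := by
  have h := ip2_nmPoly_of_mem_degreeLT y k
    (sub_mem_degreeLT_of_monic hg hd ((nmPoly_spec y).monic k) ((nmPoly_spec y).natDegree k))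
  have h' : ip2Bilin y (nmPoly y k) (g - nmPoly y k) = 0 := h
  rw [map_sub, sub_eq_zero] at h'
  exact h'

theorem monic_X_mul_sub_derivative {f : ℝ[X]} (hf : f.Monic) :
    (X * f - derivative f).Monic ∧ (X * f - derivative f).natDegree = f.natDegree + 1 := by
  have hm : (X * f).Monic := monic_X.mul hf
  have hlt : (derivative f).degree < (X * f).degree := by
    rw [degree_mul, degree_X, degree_eq_natDegree hf.ne_zero]
    refine (degree_derivative_le.trans ?_).trans_lt
      (show (f.natDegree : WithBot ℕ) < 1 + f.natDegree from ?_)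
    · exact degree_le_natDegree
    · exact_mod_cast (by omega : f.natDegree < 1 + f.natDegree)
  refine ⟨hm.sub_of_left hlt, ?_⟩
  rw [natDegree_eq_of_degree_eq (degree_sub_eq_left_of_degree_lt hlt),
    natDegree_X_mul hf.ne_zero]

/-- X p_j - p_j' is monic of degree j + 1 ≤ k, so its product with p_k is h_k when j + 1 = k and
zero otherwise. -/
theorem skewForm_nmPoly_of_lt (y : ℝ) {j k : ℕ} (hjk : j < k) :
    skewForm ℝ y (nmPoly y j) (nmPoly y k) =
      (if j + 1 = k then nmNorm y k else 0) + omegaEntry y j k / 2 := by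
  obtain ⟨hm, hd⟩ := monic_X_mul_sub_derivative ((nmPoly_spec y).monic j)
  rw [(nmPoly_spec y).natDegree j] at hd
  rw [skewForm_eq_add, omegaEntry, add_comm]
  congr 1
  split_ifs with h
  · exact ip2_nmPoly_of_monic y k hm (hd.trans h)
  · exact ip2_nmPoly_of_mem_degreeLT y k (mem_degreeLT_of_natDegree_lt (by omega))

theorem skewForm_nmPoly (y : ℝ) (j k : ℕ) :
    skewForm ℝ y (nmPoly y j) (nmPoly y k) = wEntry y j k := by
  rw [wEntry]
  split_ifs with h1 h2 h3 h4
  all_goals first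
    | rw [skewForm_nmPoly_of_lt y h1]; simp [*]
    | rw [← (skewForm_isAlt y).neg, skewForm_nmPoly_of_lt y ‹k < j›]; simp [*]
    | obtain rfl : j = k := by omega
      exact skewForm_isAlt y _

variable {𝕜 : Type*} [RCLike 𝕜]

theorem skewForm_nmPolyK (y : ℝ) (j k : ℕ) :
    skewForm 𝕜 y (nmPolyK 𝕜 y j) (nmPolyK 𝕜 y k) = ((wEntry y j k : ℝ) : 𝕜) := by
  rw [nmPolyK, nmPolyK, skewForm_map, skewForm_nmPoly]

theorem monic_nmPolyK (y : ℝ) (j : ℕ) : (nmPolyK 𝕜 y j).Monic :=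
  ((nmPoly_spec y).monic j).map _

theorem natDegree_nmPolyK (y : ℝ) (j : ℕ) : (nmPolyK 𝕜 y j).natDegree = j := by
  rw [nmPolyK, ((nmPoly_spec y).monic j).natDegree_map, (nmPoly_spec y).natDegree]

/-- An arbitrary index map `u` covers both W and its versions with a replaced index. -/
theorem pfaffian_wEntry (𝕜 : Type*) [RCLike 𝕜] (y : ℝ) (n : ℕ) (u : Fin (2 * n) → ℕ) :
    ((pfaffian (Matrix.of fun a b => wEntry y (u a) (u b)) : ℝ) : 𝕜) =
      (1 / (2 ^ n * (n.factorial : 𝕜))) *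
        gramPf (skewForm 𝕜 y) n (fun i => nmPolyK 𝕜 y (u i)) := by
  simp only [gramPf_apply, pairProd_apply, pfaffian, skewForm_nmPolyK, Matrix.of_apply, pairFst,
    pairSnd]
  push_cast
  congr 1
  refine Finset.sum_congr rfl fun σ _ => ?_
  rw [Units.smul_def, zsmul_eq_mul]

theorem pfaffian_matW (𝕜 : Type*) [RCLike 𝕜] (y : ℝ) (n : ℕ) :
    ((pfaffian (matW y n) : ℝ) : 𝕜) = (1 / (2 ^ n * (n.factorial : 𝕜))) *
        gramPf (skewForm 𝕜 y) n (fun i => nmPolyK 𝕜 y i) :=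
  pfaffian_wEntry 𝕜 y n fun i => i

theorem pfaffian_matWRepl (𝕜 : Type*) [RCLike 𝕜] (y : ℝ) (n j : ℕ) (k : Fin (2 * n)) :
    ((pfaffian (matWRepl y n k j) : ℝ) : 𝕜) = (1 / (2 ^ n * (n.factorial : 𝕜))) *
        gramPf (skewForm 𝕜 y) n
          (Function.update (fun i : Fin (2 * n) => nmPolyK 𝕜 y i) k (nmPolyK 𝕜 y j)) := by
  rw [matWRepl, pfaffian_wEntry 𝕜 y n fun a => if a.1 = k.1 then j else a.1]
  congr 2
  funext i
  rw [Function.update_apply]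
  simp only [Fin.ext_iff]
  split_ifs <;> rfl

/-- Proved over ℝ, where definiteness of `ip2` applies; real Pfaffians then carry it over to 𝕜. -/
theorem gramPf_nmPoly_ne_zero (y : ℝ) (n : ℕ) :
    gramPf (skewForm ℝ y) n (fun i => nmPolyK ℝ y i) ≠ 0 := by
  induction n with
  | zero =>
    rw [gramPf_zero]
    exact one_ne_zero
  | succ n ih =>
    have hm := monic_nmPolyK (𝕜 := ℝ) y
    have hd := natDegree_nmPolyK (𝕜 := ℝ) y
    obtain ⟨c, hc⟩ := exists_orthogonal_correction _ (skewForm_isAlt y) _ ih (nmPolyK ℝ y (2 * n))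
    set r : ℝ[X] := ∑ k, c k • nmPolyK ℝ y k.1 with hr
    have hrmem : r ∈ degreeLT ℝ (2 * n) := Submodule.sum_mem _ fun k _ =>
      Submodule.smul_mem _ _ (mem_degreeLT_of_natDegree_lt (by rw [hd]; exact k.2))
    have hrdeg : r.degree < (nmPolyK ℝ y (2 * n)).degree := by
      rw [degree_eq_natDegree (hm _).ne_zero, hd]
      exact mem_degreeLT.1 hrmem
    have ham : (nmPolyK ℝ y (2 * n) + r).Monic := (hm _).add_of_left hrdeg
    have had : (nmPolyK ℝ y (2 * n) + r).natDegree = 2 * n := by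
      rw [natDegree_eq_of_degree_eq (degree_add_eq_left_of_degree_lt hrdeg), hd]
    -- The second vector need only be monic of degree 2n + 1; multiplying the first by X makes their
    -- pairing half a square norm.
    rw [gramPf_succ_of_orthogonal _ (skewForm_isAlt y) (nmPolyK ℝ y) n
      (nmPolyK ℝ y (2 * n) + r) (X * (nmPolyK ℝ y (2 * n) + r))]
    · rw [skewForm_X_mul]
      refine mul_ne_zero (by positivity) (mul_ne_zero (div_ne_zero ?_ two_ne_zero) ih)
      exact fun h => ham.ne_zero (ip2_self_eq_zero y _ h)
    · rw [← degreeLT_eq_span_of_monic hm hd]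
      exact sub_mem_degreeLT_of_monic ham had (hm _) (hd _)
    · exact fun i hi => hc ⟨i, hi⟩
    · rw [← degreeLT_eq_span_of_monic hm hd]
      exact sub_mem_degreeLT_of_monic (monic_X.mul ham)
        (by rw [natDegree_X_mul ham.ne_zero, had]) (hm _) (hd _)

theorem pfaffian_matW_ne_zero (y : ℝ) (n : ℕ) : pfaffian (matW y n) ≠ 0 := by
  have h := pfaffian_matW ℝ y n
  rw [RCLike.ofReal_real_eq_id, id] at h
  rw [h]
  exact mul_ne_zero (by positivity) (gramPf_nmPoly_ne_zero y n)

theorem gramPf_nmPolyK_ne_zero (𝕜 : Type*) [RCLike 𝕜] (y : ℝ) (n : ℕ) :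
    gramPf (skewForm 𝕜 y) n (fun i => nmPolyK 𝕜 y i) ≠ 0 := by
  intro h
  have h' := pfaffian_matW 𝕜 y n
  rw [h, mul_zero, RCLike.ofReal_eq_zero] at h'
  exact pfaffian_matW_ne_zero y n h'

end Gram

/-! ### Existence, normalisations and coefficients -/

section SkewOrthogonal

variable {𝕜 : Type*} [RCLike 𝕜]

theorem exists_isSkewOrthogonal (𝕜 : Type*) [RCLike 𝕜] (y : ℝ) :
    ∃ (Q : ℕ → 𝕜[X]) (q : ℕ → 𝕜) (α : ℕ → ℕ → 𝕜),
      IsSkewOrthogonal y Q q ∧ HasCoefficients y Q α ∧ ∀ n : ℕ, α (2 * n + 1) (2 * n) = 0 := by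
  have hm := monic_nmPolyK (𝕜 := 𝕜) y
  have hd := natDegree_nmPolyK (𝕜 := 𝕜) y
  -- The bound 2 * (j / 2) equals 2n for both j = 2n and j = 2n + 1. For odd j no multiple of
  -- p_{j-1} is added, so that coefficient is zero by construction.
  have hex : ∀ j : ℕ, ∃ c : ℕ → 𝕜, ∀ i < 2 * (j / 2), skewForm 𝕜 y (nmPolyK 𝕜 y j +
      ∑ k ∈ Finset.range (2 * (j / 2)), c k • nmPolyK 𝕜 y k) (nmPolyK 𝕜 y i) = 0 := by
    intro j
    obtain ⟨c, hc⟩ := exists_orthogonal_correction _ (skewForm_isAlt y) _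
      (gramPf_nmPolyK_ne_zero 𝕜 y (j / 2)) (nmPolyK 𝕜 y j)
    refine ⟨fun k => if h : k < 2 * (j / 2) then c ⟨k, h⟩ else 0, fun i hi => ?_⟩
    rw [Finset.sum_range]
    simpa using hc ⟨i, hi⟩
  choose c hc using hex
  set r : ℕ → 𝕜[X] := fun j => ∑ k ∈ Finset.range (2 * (j / 2)), c j k • nmPolyK 𝕜 y k with hr
  have hrdeg : ∀ j, (r j).degree < (nmPolyK 𝕜 y j).degree := by
    intro j
    rw [degree_eq_natDegree (hm _).ne_zero, hd]
    refine mem_degreeLT.1 (Submodule.sum_mem _ fun k hk =>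
      Submodule.smul_mem _ _ (mem_degreeLT_of_natDegree_lt ?_))
    rw [hd]
    have := Finset.mem_range.1 hk
    omega
  set Q : ℕ → 𝕜[X] := fun j => nmPolyK 𝕜 y j + r j with hQ
  have hQm : ∀ j, (Q j).Monic := fun j => (hm j).add_of_left (hrdeg j)
  have hQd : ∀ j, (Q j).natDegree = j := fun j => by
    rw [hQ, natDegree_eq_of_degree_eq (degree_add_eq_left_of_degree_lt (hrdeg j)), hd]
  have hlt : ∀ i j, i / 2 < j / 2 → skewForm 𝕜 y (Q j) (Q i) = 0 := fun i j hij =>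
    apply_eq_zero_of_mem_degreeLT hm hd _ (hc j)
      (mem_degreeLT_of_natDegree_lt (by rw [hQd]; omega))
  have hne : ∀ i j, i / 2 ≠ j / 2 → skewForm 𝕜 y (Q i) (Q j) = 0 := by
    intro i j hij
    rcases lt_or_gt_of_ne hij with h | h
    · rw [← (skewForm_isAlt y).neg, hlt i j h, neg_zero]
    · exact hlt j i h
  have hpair : ∀ i j, skewForm 𝕜 y (Q (2 * i)) (Q (2 * j + 1)) =
      if i = j then skewForm 𝕜 y (Q (2 * i)) (Q (2 * i + 1)) else 0 := by
    intro i j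
    split_ifs with h
    · rw [h]
    · exact hne _ _ (by omega)
  refine ⟨Q, fun i => skewForm 𝕜 y (Q (2 * i)) (Q (2 * i + 1)),
    fun j k => if k = j then 1 else if k < 2 * (j / 2) then c j k else 0,
    ⟨hQm, hQd, fun i j => ?_, fun i j => ?_, fun i j => ?_, fun i j => ?_⟩, fun j => ?_,
    fun n => ?_⟩
  · rw [← skewForm_apply]
    by_cases h : i = j
    · rw [h]; exact skewForm_isAlt y _
    · exact hne _ _ (by omega)
  · rw [← skewForm_apply]
    by_cases h : i = j
    · rw [h]; exact skewForm_isAlt y _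
    · exact hne _ _ (by omega)
  · rw [← skewForm_apply, hpair]
  · rw [← skewForm_apply, ← (skewForm_isAlt y).neg, hpair]
  · beta_reduce
    rw [Finset.sum_range_succ, if_pos rfl, C_1, one_mul, add_comm]
    change nmPolyK 𝕜 y j + r j = _
    congr 1
    have hsub : Finset.range (2 * (j / 2)) ⊆ Finset.range j :=
      Finset.range_subset_range.2 (by omega)
    rw [← Finset.sum_subset hsub]
    · refine Finset.sum_congr rfl fun k hk => ?_
      have := Finset.mem_range.1 hk
      rw [if_neg (by omega), if_pos this, smul_eq_C_mul]
    · intro k hk hk'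
      rw [Finset.mem_range] at hk hk'
      rw [if_neg (by omega), if_neg hk', C_0, zero_mul]
  · beta_reduce
    rw [if_neg (by omega), if_neg (by omega)]

/-- Polynomials of degree below 2 * (m / 2) are spanned by the Q_i from earlier pairs, all
orthogonal to Q_m. -/
theorem IsSkewOrthogonal.skewForm_eq_zero {y : ℝ} {Q : ℕ → 𝕜[X]} {q : ℕ → 𝕜}
    (hQ : IsSkewOrthogonal y Q q) (m : ℕ) {g : 𝕜[X]} (hg : g ∈ degreeLT 𝕜 (2 * (m / 2))) :
    skewForm 𝕜 y (Q m) g = 0 := by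
  refine apply_eq_zero_of_mem_degreeLT hQ.monic hQ.natDegree _ (fun i hi => ?_) hg
  rw [skewForm_apply]
  rcases Nat.even_or_odd' m with ⟨a, rfl | rfl⟩ <;> rcases Nat.even_or_odd' i with ⟨b, rfl | rfl⟩
  · exact hQ.even_even a b
  · rw [hQ.even_odd, if_neg (by omega)]
  · rw [hQ.odd_even, if_neg (by omega), neg_zero]
  · exact hQ.odd_odd a b

/-- The recursion with a = Q_{2j} and b = Q_{2j+1}; its factor 2 (j + 1) cancels against the ratio
of the Pfaffian prefactors. -/
theorem IsSkewOrthogonal.normalisation_eq {y : ℝ} {Q : ℕ → 𝕜[X]} {q : ℕ → 𝕜}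
    (hQ : IsSkewOrthogonal y Q q) (j : ℕ) :
    q j = ((pfaffian (matW y (j + 1)) / pfaffian (matW y j) : ℝ) : 𝕜) := by
  have hm := monic_nmPolyK (𝕜 := 𝕜) y
  have hd := natDegree_nmPolyK (𝕜 := 𝕜) y
  have hF := gramPf_nmPolyK_ne_zero 𝕜 y j
  have h := gramPf_succ_of_orthogonal _ (skewForm_isAlt y) (nmPolyK 𝕜 y) j (Q (2 * j))
    (Q (2 * j + 1))
    (by
      rw [← degreeLT_eq_span_of_monic hm hd]
      exact sub_mem_degreeLT_of_monic (hQ.monic _) (hQ.natDegree _) (hm _) (hd _))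
    (fun i hi => hQ.skewForm_eq_zero _ (mem_degreeLT_of_natDegree_lt (by rw [hd]; omega)))
    (by
      rw [← degreeLT_eq_span_of_monic hm hd]
      exact sub_mem_degreeLT_of_monic (hQ.monic _) (hQ.natDegree _) (hm _) (hd _))
  rw [skewForm_apply, hQ.even_odd, if_pos rfl] at h
  have hfac : ((j.factorial : ℕ) : 𝕜) ≠ 0 := Nat.cast_ne_zero.2 j.factorial_ne_zero
  have hj : (j + 1 : 𝕜) ≠ 0 := Nat.cast_add_one_ne_zero j
  rw [RCLike.ofReal_div, pfaffian_matW, pfaffian_matW, h, Nat.factorial_succ]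
  push_cast
  field_simp
  ring

theorem IsSkewOrthogonal.exists_hasCoefficients {y : ℝ} {Q : ℕ → 𝕜[X]} {q : ℕ → 𝕜}
    (hQ : IsSkewOrthogonal y Q q) : ∃ α : ℕ → ℕ → 𝕜, HasCoefficients y Q α := by
  have hex : ∀ j, ∃ c : ℕ → 𝕜, ∑ k ∈ Finset.range (j + 1), c k • nmPolyK 𝕜 y k = Q j := by
    intro j
    rw [← Submodule.mem_span_image_finset_iff_exists_fun', Finset.coe_range,
      ← degreeLT_eq_span_of_monic (monic_nmPolyK y) (natDegree_nmPolyK y)]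
    exact mem_degreeLT_of_natDegree_lt (by rw [hQ.natDegree]; omega)
  choose α hα using hex
  exact ⟨α, fun j => by simp only [← smul_eq_C_mul, hα]⟩

theorem HasCoefficients.diag_eq_one {y : ℝ} {Q : ℕ → 𝕜[X]} {α : ℕ → ℕ → 𝕜}
    (hα : HasCoefficients y Q α) (hm : ∀ j, (Q j).Monic) (hd : ∀ j, (Q j).natDegree = j) (j : ℕ) :
    α j j = 1 := by
  have h := congrArg (fun f => f.coeff j) (hα j)
  have h1 : (Q j).coeff j = 1 := by simpa [hd j] using (hm j).coeff_natDegree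
  have h2 : (nmPolyK 𝕜 y j).coeff j = 1 := by
    simpa [natDegree_nmPolyK] using (monic_nmPolyK (𝕜 := 𝕜) y j).coeff_natDegree
  simp only [h1, finsetSum_coeff, coeff_C_mul] at h
  rw [Finset.sum_range_succ, h2, mul_one, Finset.sum_eq_zero, zero_add] at h
  · exact h.symm
  · intro k hk
    rw [coeff_eq_zero_of_natDegree_lt, mul_zero]
    rw [natDegree_nmPolyK]
    exact Finset.mem_range.1 hk

/-- Cramer's rule with x = p_m, for both parities of m at once. An expansion of Q_m - p_m using only
k < 2n is essential, since Q_m is known to be orthogonal only to degrees below 2n. -/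
theorem IsSkewOrthogonal.coeff_eq {y : ℝ} {Q : ℕ → 𝕜[X]} {q : ℕ → 𝕜}
    (hQ : IsSkewOrthogonal y Q q) (n m : ℕ) (hmn : m / 2 = n) (c : ℕ → 𝕜)
    (hc : Q m = nmPolyK 𝕜 y m + ∑ k ∈ Finset.range (2 * n), C (c k) * nmPolyK 𝕜 y k) (k : ℕ)
    (hk : k < 2 * n) :
    c k = ((-(pfaffian (matWRepl y n k m) / pfaffian (matW y n)) : ℝ) : 𝕜) := by
  have h := gramPf_update_of_orthogonal _ (skewForm_isAlt y)
    (fun i : Fin (2 * n) => nmPolyK 𝕜 y i) (nmPolyK 𝕜 y m) (fun i => c i) (fun i => by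
      have h' := hQ.skewForm_eq_zero m (g := nmPolyK 𝕜 y i)
        (mem_degreeLT_of_natDegree_lt (by rw [natDegree_nmPolyK, hmn]; exact i.2))
      rw [hc, Finset.sum_range] at h'
      simpa only [smul_eq_C_mul] using h') ⟨k, hk⟩
  have hF := gramPf_nmPolyK_ne_zero 𝕜 y n
  have hfac : ((n.factorial : ℕ) : 𝕜) ≠ 0 := Nat.cast_ne_zero.2 n.factorial_ne_zero
  rw [RCLike.ofReal_neg, RCLike.ofReal_div, pfaffian_matWRepl 𝕜 y n m ⟨k, hk⟩, pfaffian_matW, h]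
  field_simp

end SkewOrthogonal

theorem propositionp {𝕜 : Type*} [RCLike 𝕜] (y : ℝ) :
    -- the entries of `W` are the skew-inner products of the `p_j`
    (∀ j k : ℕ, skewIP4 y (nmPolyK 𝕜 y j) (nmPolyK 𝕜 y k) = ((wEntry y j k : ℝ) : 𝕜)) ∧
    -- the denominators do not vanish
    (∀ n : ℕ, pfaffian (matW y n) ≠ 0) ∧
    -- skew-orthogonal polynomials with `α_{j,j-1} = 0` for odd `j` exist
    (∃ (Q : ℕ → 𝕜[X]) (q : ℕ → 𝕜) (α : ℕ → ℕ → 𝕜),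
      IsSkewOrthogonal y Q q ∧ HasCoefficients y Q α ∧ ∀ n : ℕ, α (2 * n + 1) (2 * n) = 0) ∧
    -- and all skew-orthogonal polynomials are as follows
    (∀ (Q : ℕ → 𝕜[X]) (q : ℕ → 𝕜), IsSkewOrthogonal y Q q →
      (∀ j : ℕ, q j = ((pfaffian (matW y (j + 1)) / pfaffian (matW y j) : ℝ) : 𝕜)) ∧
      (∃ α : ℕ → ℕ → 𝕜, HasCoefficients y Q α) ∧
      ∀ α : ℕ → ℕ → 𝕜, HasCoefficients y Q α →
        (∀ j : ℕ, α j j = 1) ∧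
        ((∀ n : ℕ, α (2 * n + 1) (2 * n) = 0) →
          ∀ n : ℕ, 1 ≤ n → ∀ k : ℕ, k < 2 * n →
            α (2 * n) k =
              ((-(pfaffian (matWRepl y n k (2 * n)) / pfaffian (matW y n)) : ℝ) : 𝕜) ∧
            α (2 * n + 1) k =
              ((-(pfaffian (matWRepl y n k (2 * n + 1)) / pfaffian (matW y n)) : ℝ) : 𝕜))) := by
  refine ⟨fun j k => by rw [← skewForm_apply, skewForm_nmPolyK], pfaffian_matW_ne_zero y,
    exists_isSkewOrthogonal 𝕜 y, fun Q q hQ => ⟨hQ.normalisation_eq, hQ.exists_hasCoefficients,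
    fun α hα => ?_⟩⟩
  have hdiag := hα.diag_eq_one hQ.monic hQ.natDegree
  refine ⟨hdiag, fun h0 n _ k hk => ⟨?_, ?_⟩⟩
  · refine hQ.coeff_eq n (2 * n) (by omega) (α (2 * n)) ?_ k hk
    rw [hα (2 * n), Finset.sum_range_succ, hdiag, C_1, one_mul, add_comm]
  · refine hQ.coeff_eq n (2 * n + 1) (by omega) (α (2 * n + 1)) ?_ k hk
    -- The condition α_{2n+1,2n} = 0 removes p_{2n}, leaving only the indices k < 2n.
    rw [hα (2 * n + 1), Finset.sum_range_succ, Finset.sum_range_succ, hdiag, h0, C_1, C_0, one_mul,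
      zero_mul, add_zero, add_comm]
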